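/- Let $K$ be a field of characteristic $0$. For a $K$-algebra $A$ (associative, with $1$) and a finite-dimensional subspace $V\subseteq A$ with $1\in V$, put $$g(V)=\limsup_{m\to\infty}\frac{\log\dim_K V^m}{\log m}\in[-\infty,\infty],$$ and let $\operatorname{GKdim}(A)$ be the supremum of $g(V)$ over all such $V$. For an integer $n\ge 1$ let $\mathcal A_n$ be the associative unital $K$-algebra with generators $x_1,\dots,x_n,y,z_1,\dots,z_n$ and defining relations (where $[a,b]=ab-ba$) $$[x_1,y]=[y,z_1]=1,\qquad [x_i,z_i]=1\ (2\le i\le n),\qquad [x_1,z_1]=-x_1y-yz_1,$$ $$[x_i,x_j]=[x_i,z_j]=[z_i,z_j]=0\ (i\ne j),\qquad [x_i,y]=[y,z_i]=0\ (2\le i\le n).$$ Then, for every $n\ge 1$, $\mathcal A_n$ is a finitely generated simple algebra (it is nonzero and its only two-sided ideals are $0$ and $\mathcal A_n$) with $\operatorname{GKdim}(\mathcal A_n)=2n+1$; moreover $g(V)=2n+1$ for every finite-dimensional subspace $V\ni 1$ that generates $\mathcal A_n$ as an algebra. Consequently, for every odd integer $d\ge 3$ there is a finitely generated simple $K$-algebra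 of Gelfand–Kirillov dimension $d$. -/

import Mathlib

universe u v

/-- The number `limsup (log dim V^m) / log m` attached to a subspace `V` of an algebra. It is an
extended real, so that no boundedness is presupposed; the terms `m = 0, 1` do not matter. -/
noncomputable def growthExponent (K : Type u) {A : Type v} [Field K] [Ring A] [Algebra K A]
    (V : Submodule K A) : EReal :=
  Filter.limsup
    (fun m : ℕ =>
      ((Real.log (Module.finrank K (V ^ m : Submodule K A) : ℝ) / Real.log (m : ℝ) : ℝ) : EReal))
    Filter.atTop

/-- The Gel'fand-Kirillov dimension of an algebra: the supremum of the growth exponents of the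
finite-dimensional subspaces containing `1`. For a finitely generated algebra it is attained at
every finite-dimensional generating subspace containing `1`. -/
noncomputable def gkDim (K : Type u) (A : Type v) [Field K] [Ring A] [Algebra K A] : EReal :=
  ⨆ (V : Submodule K A) (_ : FiniteDimensional K V) (_ : (1 : A) ∈ V), growthExponent K V

/-- The letters `x_1, …, x_n, y, z_1, …, z_n`. The index `i : Fin n` stands for `i + 1`, so that
`x_1` and `z_1` are the letters whose index has value `0`. -/
inductive OddGen (n : ℕ) : Type
  | x (i : Fin n) : OddGen n
  | y : OddGen n
  | z (i : Fin n) : OddGen n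

namespace OddGen

/-- The letter `x_{i+1}` in the free algebra. -/
def X (K : Type u) [Field K] {n : ℕ} (i : Fin n) : FreeAlgebra K (OddGen n) :=
  FreeAlgebra.ι K (OddGen.x i)

/-- The letter `y` in the free algebra. -/
def Y (K : Type u) [Field K] (n : ℕ) : FreeAlgebra K (OddGen n) :=
  FreeAlgebra.ι K OddGen.y

/-- The letter `z_{i+1}` in the free algebra. -/
def Z (K : Type u) [Field K] {n : ℕ} (i : Fin n) : FreeAlgebra K (OddGen n) :=
  FreeAlgebra.ι K (OddGen.z i)

end OddGen

open OddGen in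
/-- The defining relations of the algebra `A_n`; here `⁅a, b⁆ = a * b - b * a`. -/
inductive OddRel (K : Type u) [Field K] (n : ℕ) :
    FreeAlgebra K (OddGen n) → FreeAlgebra K (OddGen n) → Prop
  | x_one_y (i : Fin n) (hi : (i : ℕ) = 0) : OddRel K n ⁅X K i, Y K n⁆ 1
  | y_z_one (i : Fin n) (hi : (i : ℕ) = 0) : OddRel K n ⁅Y K n, Z K i⁆ 1
  | x_z_same (i : Fin n) (hi : (i : ℕ) ≠ 0) : OddRel K n ⁅X K i, Z K i⁆ 1
  | x_one_z_one (i : Fin n) (hi : (i : ℕ) = 0) :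
      OddRel K n ⁅X K i, Z K i⁆ (-(X K i * Y K n) - Y K n * Z K i)
  | x_x (i j : Fin n) (hij : i ≠ j) : OddRel K n ⁅X K i, X K j⁆ 0
  | x_z (i j : Fin n) (hij : i ≠ j) : OddRel K n ⁅X K i, Z K j⁆ 0
  | z_z (i j : Fin n) (hij : i ≠ j) : OddRel K n ⁅Z K i, Z K j⁆ 0
  | x_y (i : Fin n) (hi : (i : ℕ) ≠ 0) : OddRel K n ⁅X K i, Y K n⁆ 0
  | y_z (i : Fin n) (hi : (i : ℕ) ≠ 0) : OddRel K n ⁅Y K n, Z K i⁆ 0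

/-- The algebra `A_n`: the free unital associative algebra on `x_1, …, x_n, y, z_1, …, z_n`
modulo the two-sided ideal generated by the defining relations. -/
abbrev OddAlgebra (K : Type u) [Field K] (n : ℕ) : Type u := RingQuot (OddRel K n)

/-!
The algebra `A_n` is an iterated differential operator ring in disguise. Put `t_1 = y`, `t_i = z_i`
for `i ≥ 2` and `u = x_1 + z_1`. Then `t_1, …, t_n, u` commute, the `x_i` commute, and `[x_i, s]` is
`D_i s` for `s` a polynomial in `t, u`, where `D_i t_j = δ_ij`, `D_1 u = -(1 + t_1 u)` and `D_i u = 0`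
for `i ≥ 2` (`OddAlgebra.isShamsuddinSystem`). So `A_n` is the ring `K[t, u][x; D]`, whose elements
are written `∑ s_α x ^ α` with `s_α` in `K[t, u]` (`IsShamsuddinSystem.normalForm`).

Simplicity. The polynomial ring `K[t, u]` has no proper nonzero ideal stable under all `D_i`
(`one_mem_of_shamsuddinDerivation_mem`), the reason being that `∂b/∂t + t b = a` has no polynomial
solution for a nonzero constant `a`. Since the commutator with `t_i` acts on normal forms as the
partial derivative `∂/∂x_i`, an ideal containing the value of a nonzero normal form contains a
nonzero element of `K[t, u]`, and then `1` (`IsShamsuddinSystem.one_mem_of_normalForm_mem`). For the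
zero ideal this says that the normal form is unique, for the other ideals it gives simplicity. Only
the fact that `A_n` is not zero needs a representation, namely by differential operators on
`K[t, u]` (`OddAlgebra.nontrivial`).

Growth. As each `D_i` raises the total degree by at most one, products of `m` generators are
combinations of ordered monomials of total degree at most `m` in the `2 n + 1` letters `t, u, x`,
and these monomials are linearly independent. Hence the powers `V ^ m` of a generating subspace have
dimension between two positive multiples of `m ^ (2 n + 1)` for `m ≥ 1`
(`IsShamsuddinSystem.growthExponent_eq`).
-/

open MvPolynomial
open scoped TensorProduct

/-! ### Partial derivatives and total degree -/

section Polynomial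

variable {σ R : Type*}

theorem MvPolynomial.totalDegree_pderiv_lt [CommSemiring R] {i : σ} {p : MvPolynomial σ R}
    (h : pderiv i p ≠ 0) : (pderiv i p).totalDegree < p.totalDegree := by
  have key : ∀ m ∈ (pderiv i p).support, (m.sum fun _ e => e) + 1 ≤ p.totalDegree := by
    intro m hm
    rw [mem_support_iff, coeff_pderiv] at hm
    have h1 : m + Finsupp.single i 1 ∈ p.support :=
      mem_support_iff.2 (left_ne_zero_of_mul hm)
    have h2 := le_totalDegree h1
    rwa [Finsupp.sum_add_index' (fun _ => rfl) (fun _ _ _ => rfl),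
      Finsupp.sum_single_index rfl] at h2
  obtain ⟨m, hm⟩ := support_nonempty.2 h
  have hpos : 0 < p.totalDegree := (Nat.succ_pos _).trans_le (key m hm)
  rw [totalDegree, Finset.sup_lt_iff (by simpa using hpos)]
  exact fun m hm => key m hm

theorem MvPolynomial.totalDegree_pderiv_le [CommSemiring R] (i : σ) (p : MvPolynomial σ R) :
    (pderiv i p).totalDegree ≤ p.totalDegree := by
  by_cases h : pderiv i p = 0
  · simp [h]
  · exact (totalDegree_pderiv_lt h).le

theorem MvPolynomial.eq_C_of_forall_pderiv_eq_zero [CommRing R] [NoZeroDivisors R] [CharZero R]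
    {p : MvPolynomial σ R} (h : ∀ i, pderiv i p = 0) : p = C (coeff 0 p) := by
  classical
  ext m
  rw [coeff_C]
  split_ifs with hm
  · rw [hm]
  obtain ⟨i, hi⟩ : ∃ i, m i ≠ 0 := by
    by_contra! hall
    exact hm (Finsupp.ext fun i => (hall i).symm)
  have h1 := coeff_pderiv (i := i) p (m - Finsupp.single i 1)
  have h2 : Finsupp.single i 1 ≤ m := by
    simpa [Finsupp.single_le_iff] using Nat.one_le_iff_ne_zero.2 hi
  rw [h i, tsub_add_cancel_of_le h2, coeff_zero] at h1
  exact (mul_eq_zero.1 h1.symm).resolve_right (Nat.cast_add_one_ne_zero _)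

/-- A derivative lowers the total degree, so a nonzero element of least total degree is killed by
all partial derivatives; in characteristic zero it is a constant. -/
theorem MvPolynomial.exists_C_mem_of_pderiv_mem [CommRing R] [NoZeroDivisors R] [CharZero R]
    (N : Set (MvPolynomial σ R)) (hN : ∀ i, ∀ p ∈ N, pderiv i p ∈ N)
    {p : MvPolynomial σ R} (hp : p ∈ N) (hp0 : p ≠ 0) : ∃ c : R, c ≠ 0 ∧ C c ∈ N := by
  induction hd : p.totalDegree using Nat.strong_induction_on generalizing p with
  | _ d ih =>
    by_cases hall : ∀ i, pderiv i p = 0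
    · have hC := eq_C_of_forall_pderiv_eq_zero hall
      refine ⟨coeff 0 p, fun h => hp0 ?_, hC ▸ hp⟩
      rw [hC, h, C_0]
    · push Not at hall
      obtain ⟨i, hi⟩ := hall
      exact ih _ (hd ▸ totalDegree_pderiv_lt hi) (hN i p hp) hi rfl

/-- The equation `∂b/∂t + t b = a` has no polynomial solution `b` for a nonzero constant `a`,
since `t b` has larger total degree than `b`. -/
theorem MvPolynomial.eq_zero_of_pderiv_add_X_mul_eq_C [CommRing R] [IsDomain R] {i : σ}
    {b : MvPolynomial σ R} {a : R} (h : pderiv i b + X i * b = C a) : a = 0 := by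
  by_cases hb : b = 0
  · simpa [hb] using h.symm
  exfalso
  have h1 : (X i * b).totalDegree = 1 + b.totalDegree := by
    rw [totalDegree_mul_of_isDomain (X_ne_zero i) hb, totalDegree_X]
  have h2 : X i * b = C a - pderiv i b := by rw [← h]; ring
  have h3 := totalDegree_sub (C a) (pderiv i b)
  rw [← h2, h1, totalDegree_C] at h3
  have h4 := totalDegree_pderiv_le i b
  simp only [zero_le, sup_of_le_right] at h3
  omega

end Polynomial

/-! ### The derivations `D_i` of `K[t, u]` -/

section Derivation

variable (K : Type*) [Field K] {ι : Type*} [DecidableEq ι] (o : ι)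

/-- The derivations `D_i` of the polynomial ring `K[t_i (i ∈ ι), u]`, where `t_i` is the variable
`some i` and `u` is the variable `none`: `D_i t_j = δ_ij`, while `D_i u = 0` for `i ≠ o` and
`D_o u = -(1 + t_o u)`. -/
noncomputable def shamsuddinDerivation (i : ι) :
    Derivation K (MvPolynomial (Option ι) K) (MvPolynomial (Option ι) K) :=
  mkDerivation K fun j => j.elim (if i = o then -(1 + X (some o) * X none) else 0)
    fun l => if i = l then 1 else 0

theorem shamsuddinDerivation_X_some (i l : ι) :
    shamsuddinDerivation K o i (X (some l)) = if i = l then 1 else 0 := by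
  simp [shamsuddinDerivation]

theorem shamsuddinDerivation_X_none (i : ι) :
    shamsuddinDerivation K o i (X none) = if i = o then -(1 + X (some o) * X none) else 0 := by
  simp [shamsuddinDerivation]

theorem shamsuddinDerivation_comm (i j : ι) (f : MvPolynomial (Option ι) K) :
    shamsuddinDerivation K o i (shamsuddinDerivation K o j f) =
      shamsuddinDerivation K o j (shamsuddinDerivation K o i f) := by
  have h : ⁅shamsuddinDerivation K o i, shamsuddinDerivation K o j⁆ = 0 := by
    refine derivation_ext fun l => ?_
    rw [Derivation.commutator_apply]
    cases l with
    | some l =>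
      simp only [shamsuddinDerivation_X_some]
      split_ifs <;> simp
    | none =>
      simp only [shamsuddinDerivation_X_none]
      split_ifs with h1 h2 h2
      · simp [h1, h2]
      · simp [shamsuddinDerivation_X_some, shamsuddinDerivation_X_none, h1, h2]
      · simp [shamsuddinDerivation_X_some, shamsuddinDerivation_X_none, h1, h2]
      · simp
  have h2 := DFunLike.congr_fun h f
  rw [Derivation.commutator_apply] at h2
  exact sub_eq_zero.1 h2

/-- The action of `D_i` on the coefficients of a polynomial in `u` over `K[t]`. -/
theorem coeff_optionEquivLeft_shamsuddinDerivation (i : ι) (f : MvPolynomial (Option ι) K) (j : ℕ) :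
    (optionEquivLeft K ι (shamsuddinDerivation K o i f)).coeff j =
      pderiv i ((optionEquivLeft K ι f).coeff j) -
        if i = o then (j + 1 : MvPolynomial ι K) * (optionEquivLeft K ι f).coeff (j + 1) +
          (j : MvPolynomial ι K) * X o * (optionEquivLeft K ι f).coeff j else 0 := by
  induction f using MvPolynomial.induction_on generalizing j with
  | C a =>
    rw [derivation_C, map_zero, Polynomial.coeff_zero, optionEquivLeft_C, Polynomial.coeff_C,
      Polynomial.coeff_C_succ]
    split_ifs <;> simp_all
  | add p q hp hq =>
    simp only [map_add, Polynomial.coeff_add, hp, hq]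
    split_ifs <;> ring
  | mul_X p l hp =>
    rw [Derivation.leibniz, map_add, smul_eq_mul, smul_eq_mul, map_mul, map_mul, map_mul]
    cases l with
    | some l =>
      have h1 : optionEquivLeft K ι (if i = l then 1 else 0) =
          Polynomial.C (if i = l then 1 else 0) := by split_ifs <;> simp
      rw [shamsuddinDerivation_X_some, h1, optionEquivLeft_X_some]
      simp only [Polynomial.coeff_add, Polynomial.coeff_C_mul, Polynomial.coeff_mul_C, hp,
        Derivation.leibniz, smul_eq_mul, pderiv_X, Pi.single_apply, eq_comm (a := l)]
      split_ifs <;> ring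
    | none =>
      have h1 : optionEquivLeft K ι (if i = o then -(1 + X (some o) * X none) else 0) =
          if i = o then -(1 + Polynomial.C (X o) * Polynomial.X) else 0 := by
        split_ifs <;> simp [optionEquivLeft_X_some, optionEquivLeft_X_none]
      rw [shamsuddinDerivation_X_none, h1, optionEquivLeft_X_none]
      have h2 : ∀ P : Polynomial (MvPolynomial ι K),
          P * (if i = o then -(1 + Polynomial.C (X o) * Polynomial.X) else 0) =
            if i = o then -P - Polynomial.C (X o) * (P * Polynomial.X) else 0 := by
        intro P; split_ifs <;> ring
      rw [h2]
      cases j with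
      | zero =>
        simp only [Polynomial.coeff_add, Polynomial.coeff_X_mul_zero, Polynomial.coeff_mul_X_zero,
          Polynomial.coeff_mul_X, map_zero]
        split_ifs <;> simp
      | succ j =>
        simp only [Polynomial.coeff_add, Polynomial.coeff_X_mul, Polynomial.coeff_mul_X, hp]
        split_ifs
        · simp
          ring
        · simp

/-- Each `D_i` raises the total degree by at most one, because `D_i` of a variable has degree at most
two. This lets the generators `x_i`, `t_i`, `u` all be given degree one. -/
theorem totalDegree_shamsuddinDerivation_le (i : ι) (s : MvPolynomial (Option ι) K) :
    (shamsuddinDerivation K o i s).totalDegree ≤ s.totalDegree + 1 := by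
  have hX : ∀ j : Option ι, (shamsuddinDerivation K o i (X j)).totalDegree ≤ 2 := by
    rintro (_ | l)
    · rw [shamsuddinDerivation_X_none]
      split_ifs
      · rw [totalDegree_neg]
        have h1 := totalDegree_add (1 : MvPolynomial (Option ι) K) (X (some o) * X none)
        have h2 := totalDegree_mul (X (some o) : MvPolynomial (Option ι) K) (X none)
        rw [totalDegree_X, totalDegree_X] at h2
        rw [totalDegree_one] at h1
        omega
      · simp
    · rw [shamsuddinDerivation_X_some]
      split_ifs <;> simp
  conv_lhs => rw [s.as_sum, map_sum]
  refine totalDegree_finsetSum_le fun α hα => ?_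
  have hα := le_totalDegree hα
  rw [shamsuddinDerivation, mkDerivation_monomial]
  refine (totalDegree_smul_le _ _).trans (totalDegree_finsetSum_le fun j hj => ?_)
  have h1 : Finsupp.single j 1 ≤ α := by
    simpa [Finsupp.single_le_iff] using Nat.one_le_iff_ne_zero.2 (Finsupp.mem_support_iff.1 hj)
  have h2 : ((α - Finsupp.single j 1).sum fun _ e => e) + 1 = α.sum fun _ e => e := by
    conv_rhs => rw [← tsub_add_cancel_of_le h1]
    rw [Finsupp.sum_add_index' (fun _ => rfl) (fun _ _ _ => rfl), Finsupp.sum_single_index rfl]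
  have h3 := totalDegree_monomial_le (α - Finsupp.single j 1) (α j : K)
  have h4 := hX j
  rw [shamsuddinDerivation, mkDerivation_X] at h4
  refine (totalDegree_mul _ _).trans ?_
  simp only [Function.id_def] at h3
  omega

end Derivation

/-! ### Stable ideals of `K[t, u]` -/

section Simple

variable {K : Type*} [Field K] [CharZero K] {ι : Type*} [DecidableEq ι] (o : ι)

/-- The polynomial ring `K[t, u]` has no proper nonzero ideal stable under all `D_i`. Among the
nonzero elements of such an ideal consider those of least degree `d` in `u`. Their leading
coefficients are stable under the partial derivatives of `K[t]`, so one of these elements has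
constant leading coefficient. Then `(D_o + d t_o) f` has smaller degree, hence is zero, and its
coefficient at `u ^ (d - 1)` gives an unsolvable differential equation unless `d = 0`. -/
theorem one_mem_of_shamsuddinDerivation_mem (J : Ideal (MvPolynomial (Option ι) K))
    (hD : ∀ i, ∀ f ∈ J, shamsuddinDerivation K o i f ∈ J)
    {f₀ : MvPolynomial (Option ι) K} (hf₀ : f₀ ∈ J) (hf₀0 : f₀ ≠ 0) : 1 ∈ J := by
  classical
  have hex : ∃ d, ∃ f ∈ J, f ≠ 0 ∧ (optionEquivLeft K ι f).natDegree = d := ⟨_, f₀, hf₀, hf₀0, rfl⟩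
  obtain ⟨d, ⟨f₁, hf₁, hf₁0, hd₁⟩, hmin⟩ :
      ∃ d, (∃ f ∈ J, f ≠ 0 ∧ (optionEquivLeft K ι f).natDegree = d) ∧
        ∀ g ∈ J, g ≠ 0 → d ≤ (optionEquivLeft K ι g).natDegree :=
    ⟨Nat.find hex, Nat.find_spec hex, fun g hg hg0 => Nat.find_min' hex ⟨g, hg, hg0, rfl⟩⟩
  let N : Set (MvPolynomial ι K) := {a | ∃ f ∈ J,
    (∀ j, d < j → (optionEquivLeft K ι f).coeff j = 0) ∧ (optionEquivLeft K ι f).coeff d = a}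
  -- The operators `D_o + d t_o` and `D_i` for `i ≠ o` act on leading coefficients as `∂/∂t_i`.
  have hstep : ∀ i, ∀ f ∈ J, (∀ j, d < j → (optionEquivLeft K ι f).coeff j = 0) →
      ∃ g ∈ J, (∀ j, d < j → (optionEquivLeft K ι g).coeff j = 0) ∧
        (optionEquivLeft K ι g).coeff d = pderiv i ((optionEquivLeft K ι f).coeff d) ∧
        g = shamsuddinDerivation K o i f + (if i = o then C (d : K) * X (some o) else 0) * f := by
    intro i f hf hfd
    have hc : ∀ j, (optionEquivLeft K ι ((if i = o then C (d : K) * X (some o) else 0) * f)).coeff j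
        = (if i = o then (d : MvPolynomial ι K) * X o else 0) * (optionEquivLeft K ι f).coeff j := by
      intro j
      split_ifs
      · rw [map_mul, map_mul, optionEquivLeft_C, optionEquivLeft_X_some, mul_assoc,
          Polynomial.coeff_C_mul, Polynomial.coeff_C_mul, map_natCast, mul_assoc]
      · simp
    refine ⟨_, J.add_mem (hD i f hf) (J.mul_mem_left _ hf), fun j hj => ?_, ?_, rfl⟩
    · rw [map_add, Polynomial.coeff_add, hc, coeff_optionEquivLeft_shamsuddinDerivation, hfd j hj,
        hfd (j + 1) (by omega)]
      simp
    · rw [map_add, Polynomial.coeff_add, hc, coeff_optionEquivLeft_shamsuddinDerivation,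
        hfd (d + 1) (by omega)]
      split_ifs <;> ring
  have hN : ∀ i, ∀ p ∈ N, pderiv i p ∈ N := by
    rintro i _ ⟨f, hf, hfd, rfl⟩
    obtain ⟨g, hg, hgd, hgc, -⟩ := hstep i f hf hfd
    exact ⟨g, hg, hgd, hgc⟩
  have hlead : (optionEquivLeft K ι f₁).coeff d ≠ 0 := by
    rw [← hd₁]
    exact Polynomial.leadingCoeff_ne_zero.2 (by simpa using hf₁0)
  obtain ⟨c, hc0, f, hf, hfd, hfc⟩ := exists_C_mem_of_pderiv_mem N hN
    ⟨f₁, hf₁, fun j hj => Polynomial.coeff_eq_zero_of_natDegree_lt (hd₁ ▸ hj), rfl⟩ hlead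
  obtain ⟨g, hg, hgd, hgc, hgf⟩ := hstep o f hf hfd
  have hg0 : g = 0 := by
    by_contra hne
    have hle : (optionEquivLeft K ι g).natDegree ≤ d :=
      Polynomial.natDegree_le_iff_coeff_eq_zero.2 hgd
    have heq := le_antisymm hle (hmin g hg hne)
    have h1 : (optionEquivLeft K ι g).leadingCoeff ≠ 0 :=
      Polynomial.leadingCoeff_ne_zero.2 (by simpa using hne)
    rw [Polynomial.leadingCoeff, heq, hgc, hfc, pderiv_C] at h1
    exact h1 rfl
  cases d with
  | zero =>
    have h1 : optionEquivLeft K ι f = optionEquivLeft K ι (C c) := by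
      rw [optionEquivLeft_C, ← hfc]
      exact Polynomial.eq_C_of_natDegree_le_zero (Polynomial.natDegree_le_iff_coeff_eq_zero.2 hfd)
    have h2 : f = C c := (optionEquivLeft K ι).injective h1
    have h3 := J.mul_mem_left (C c⁻¹) hf
    rwa [h2, ← C_mul, inv_mul_cancel₀ hc0, C_1] at h3
  | succ k =>
    exfalso
    have h1 : (optionEquivLeft K ι g).coeff k = 0 := by simp [hg0]
    rw [hgf, if_pos rfl, map_add, Polynomial.coeff_add, coeff_optionEquivLeft_shamsuddinDerivation,
      if_pos rfl, hfc, map_mul, map_mul, optionEquivLeft_C, optionEquivLeft_X_some,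
      ← Polynomial.C_mul, Polynomial.coeff_C_mul, map_natCast] at h1
    -- The coefficient of `(D_o + d t_o) f = 0` at `u ^ (d - 1)`, with `d = k + 1`.
    have h2 : pderiv o ((optionEquivLeft K ι f).coeff k) +
        X o * (optionEquivLeft K ι f).coeff k = C (((k + 1 : ℕ) : K) * c) := by
      rw [C_mul, map_natCast]
      push_cast at h1 ⊢
      linear_combination h1
    have h3 := eq_zero_of_pderiv_add_X_mul_eq_C h2
    exact (mul_ne_zero (Nat.cast_ne_zero.2 (Nat.succ_ne_zero k)) hc0) h3

end Simple

/-! ### Iterated differential operator rings over `K[t, u]` -/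

section AevalOfCommute

variable {K A κ : Type*} [Field K] [Ring A] [Algebra K A]

open scoped IsMulCommutative in
/-- Evaluation of polynomials at a family of pairwise commuting elements of a (possibly
noncommutative) algebra. -/
noncomputable def MvPolynomial.aevalOfCommute (f : κ → A) (h : ∀ i j, f i * f j = f j * f i) :
    MvPolynomial κ K →ₐ[K] A :=
  haveI := Algebra.isMulCommutative_adjoin K (s := Set.range f)
    (by rintro _ ⟨i, rfl⟩ _ ⟨j, rfl⟩; exact h i j)
  (Algebra.adjoin K (Set.range f)).val.comp
    (aeval fun i => ⟨f i, Algebra.subset_adjoin ⟨i, rfl⟩⟩)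

open scoped IsMulCommutative in
@[simp]
theorem MvPolynomial.aevalOfCommute_X (f : κ → A) (h : ∀ i j, f i * f j = f j * f i) (i : κ) :
    aevalOfCommute (K := K) f h (X i) = f i := by
  have := Algebra.isMulCommutative_adjoin K (s := Set.range f)
    (by rintro _ ⟨i, rfl⟩ _ ⟨j, rfl⟩; exact h i j)
  unfold aevalOfCommute
  rw [AlgHom.comp_apply, aeval_X]
  rfl

end AevalOfCommute

section System

variable {K A ι : Type*} [Field K] [Ring A] [Algebra K A] [DecidableEq ι]

/-- Elements `x_i`, `t_i`, `u` of a ring that satisfy the relations of the iterated differential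
operator ring `K[t, u][x; D]`, where `D_i` is `shamsuddinDerivation K o i`. -/
structure IsShamsuddinSystem (o : ι) (x t : ι → A) (u : A) : Prop where
  x_mul_x : ∀ i j, x i * x j = x j * x i
  t_mul_t : ∀ i j, t i * t j = t j * t i
  t_mul_u : ∀ i, t i * u = u * t i
  x_mul_t : ∀ i j, x i * t j = t j * x i + if i = j then 1 else 0
  x_mul_u : ∀ i, x i * u = u * x i + if i = o then -(1 + t o * u) else 0

namespace IsShamsuddinSystem

variable {o : ι} {x t : ι → A} {u : A} (h : IsShamsuddinSystem o x t u)

variable (K) in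
/-- The homomorphism from `K[t, u]`, with `u` the variable `none`. -/
noncomputable def coeffHom : MvPolynomial (Option ι) K →ₐ[K] A :=
  aevalOfCommute (fun j => j.elim u t) <| by
    rintro (_ | i) (_ | j)
    · rfl
    · exact (h.t_mul_u j).symm
    · exact h.t_mul_u i
    · exact h.t_mul_t i j

variable (K) in
/-- The homomorphism from the polynomial ring in the `x_i`. -/
noncomputable def symbolHom : MvPolynomial ι K →ₐ[K] A :=
  aevalOfCommute x h.x_mul_x

@[simp]
theorem coeffHom_X_some (i : ι) : h.coeffHom K (X (some i)) = t i := by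
  simp [coeffHom]

@[simp]
theorem coeffHom_X_none : h.coeffHom K (X none) = u := by
  simp [coeffHom]

@[simp]
theorem symbolHom_X (i : ι) : h.symbolHom K (X i) = x i := by
  simp [symbolHom]

/-- On `K[t, u]` the commutator with `x_i` is the derivation `D_i`. -/
theorem x_mul_coeffHom (i : ι) (s : MvPolynomial (Option ι) K) :
    x i * h.coeffHom K s =
      h.coeffHom K s * x i + h.coeffHom K (shamsuddinDerivation K o i s) := by
  induction s using MvPolynomial.induction_on with
  | C a =>
    rw [derivation_C, map_zero, add_zero, ← algebraMap_eq, AlgHom.commutes, Algebra.commutes]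
  | add p q hp hq =>
    simp only [map_add, mul_add, add_mul, hp, hq]
    abel
  | mul_X p l hp =>
    have hX : x i * h.coeffHom K (X l) = h.coeffHom K (X l) * x i +
        h.coeffHom K (shamsuddinDerivation K o i (X l)) := by
      cases l with
      | some l =>
        rw [shamsuddinDerivation_X_some, coeffHom_X_some, h.x_mul_t]
        split_ifs <;> simp
      | none =>
        rw [shamsuddinDerivation_X_none, coeffHom_X_none, h.x_mul_u]
        split_ifs <;> simp
    have hcomm : h.coeffHom K (shamsuddinDerivation K o i p) * h.coeffHom K (X l) =
        h.coeffHom K (X l) * h.coeffHom K (shamsuddinDerivation K o i p) := by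
      rw [← map_mul, mul_comm, map_mul]
    rw [Derivation.leibniz, map_add, smul_eq_mul, smul_eq_mul, map_mul, map_mul, map_mul,
      ← mul_assoc, hp, add_mul, mul_assoc, hX, hcomm]
    noncomm_ring

/-- On polynomials in the `x_i` the commutator with `t_i` is the partial derivative. -/
theorem symbolHom_mul_t (i : ι) (p : MvPolynomial ι K) :
    h.symbolHom K p * t i = t i * h.symbolHom K p + h.symbolHom K (pderiv i p) := by
  induction p using MvPolynomial.induction_on with
  | C a =>
    rw [derivation_C, map_zero, add_zero, ← algebraMap_eq, AlgHom.commutes, Algebra.commutes]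
  | add p q hp hq =>
    simp only [map_add, mul_add, add_mul, hp, hq]
    abel
  | mul_X p l hp =>
    have hX : h.symbolHom K (pderiv i (X l)) = if l = i then 1 else 0 := by
      rw [pderiv_X, Pi.single_apply]
      split_ifs <;> simp
    have hcomm : h.symbolHom K (pderiv i p) * x l = x l * h.symbolHom K (pderiv i p) := by
      rw [← h.symbolHom_X (K := K) l, ← map_mul, mul_comm, map_mul]
    rw [Derivation.leibniz, map_add, smul_eq_mul, smul_eq_mul, map_mul, map_mul, map_mul, hX,
      symbolHom_X, mul_assoc, h.x_mul_t, mul_add, ← mul_assoc, hp, add_mul, hcomm]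
    noncomm_ring

variable (K) in
/-- The `K`-linear map `∑ s_α X ^ α ↦ ∑ s_α x ^ α` from polynomials in the `x_i` with coefficients
in `K[t, u]`, the coefficients being written on the left. -/
noncomputable def normalForm : MvPolynomial ι (MvPolynomial (Option ι) K) →ₗ[K] A :=
  TensorProduct.lift
      ((LinearMap.mul K A).compl₁₂ (h.coeffHom K).toLinearMap (h.symbolHom K).toLinearMap) ∘ₗ
    ((algebraTensorAlgEquiv K (MvPolynomial (Option ι) K)).symm.restrictScalars K).toLinearMap

theorem normalForm_algebraTensorAlgEquiv (s : MvPolynomial (Option ι) K) (p : MvPolynomial ι K) :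
    h.normalForm K (algebraTensorAlgEquiv K (MvPolynomial (Option ι) K) (s ⊗ₜ p)) =
      h.coeffHom K s * h.symbolHom K p := by
  rw [normalForm, LinearMap.comp_apply]
  change TensorProduct.lift _ ((algebraTensorAlgEquiv K (MvPolynomial (Option ι) K)).symm
    (algebraTensorAlgEquiv K (MvPolynomial (Option ι) K) (s ⊗ₜ p))) = _
  rw [AlgEquiv.symm_apply_apply]
  rfl

theorem normalForm_monomial (α : ι →₀ ℕ) (s : MvPolynomial (Option ι) K) :
    h.normalForm K (monomial α s) = h.coeffHom K s * h.symbolHom K (monomial α 1) := by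
  rw [← normalForm_algebraTensorAlgEquiv, algebraTensorAlgEquiv_tmul, map_monomial, map_one,
    smul_monomial, smul_eq_mul, mul_one]

theorem normalForm_C (s : MvPolynomial (Option ι) K) :
    h.normalForm K (C s) = h.coeffHom K s := by
  rw [← monomial_zero', normalForm_monomial, monomial_zero', C_1, map_one, mul_one]

/-- The commutator with `t_i` is the partial derivative with respect to `x_i`. -/
theorem normalForm_mul_t (i : ι) (p : MvPolynomial ι (MvPolynomial (Option ι) K)) :
    h.normalForm K p * t i = t i * h.normalForm K p + h.normalForm K (pderiv i p) := by
  induction p using MvPolynomial.induction_on' with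
  | monomial α s =>
    have h1 : t i * h.coeffHom K s = h.coeffHom K s * t i := by
      rw [← h.coeffHom_X_some (K := K) i, ← map_mul, mul_comm, map_mul]
    have h2 : (monomial (α - Finsupp.single i 1) (α i : K)) =
        (α i : MvPolynomial ι K) * monomial (α - Finsupp.single i 1) 1 := by
      rw [← map_natCast (C (σ := ι) (R := K)), C_mul_monomial, mul_one]
    rw [pderiv_monomial, normalForm_monomial, normalForm_monomial, mul_assoc, symbolHom_mul_t,
      mul_add, ← mul_assoc, ← mul_assoc, h1, pderiv_monomial, one_mul, h2, map_mul, map_mul,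
      map_natCast, map_natCast, mul_assoc _ (α i : A)]
  | add p q hp hq =>
    simp only [map_add, mul_add, add_mul, hp, hq]
    abel

section CharZero

variable [CharZero K]

/-- A two-sided ideal that contains the value of a nonzero polynomial is the whole ring: taking
commutators with the `t_i` one reaches a nonzero element of `K[t, u]`, and the ideal meets
`K[t, u]` in an ideal stable under the derivations `D_i`. -/
theorem one_mem_of_normalForm_mem (I : TwoSidedIdeal A)
    {p : MvPolynomial ι (MvPolynomial (Option ι) K)} (hp : p ≠ 0) (hI : h.normalForm K p ∈ I) :
    1 ∈ I := by
  obtain ⟨c, hc0, hc⟩ := exists_C_mem_of_pderiv_mem {p | h.normalForm K p ∈ I}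
    (fun i p hp => by
      have h1 := h.normalForm_mul_t i p
      rw [← sub_eq_iff_eq_add'] at h1
      rw [Set.mem_ofPred_eq, ← h1]
      exact I.sub_mem (I.mul_mem_right _ _ hp) (I.mul_mem_left _ _ hp)) hI hp
  rw [Set.mem_ofPred_eq, normalForm_C] at hc
  let J : Ideal (MvPolynomial (Option ι) K) :=
    { carrier := {s | h.coeffHom K s ∈ I}
      add_mem' := fun ha hb => by
        rw [Set.mem_ofPred_eq, map_add]
        exact I.add_mem ha hb
      zero_mem' := by
        rw [Set.mem_ofPred_eq, map_zero]
        exact I.zero_mem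
      smul_mem' := fun a b hb => by
        rw [Set.mem_ofPred_eq, smul_eq_mul, map_mul]
        exact I.mul_mem_left _ _ hb }
  have hJ : (1 : MvPolynomial (Option ι) K) ∈ J :=
    one_mem_of_shamsuddinDerivation_mem o J (fun i s (hs : h.coeffHom K s ∈ I) => by
      have h1 := h.x_mul_coeffHom i s
      rw [← sub_eq_iff_eq_add'] at h1
      change h.coeffHom K _ ∈ I
      rw [← h1]
      exact I.sub_mem (I.mul_mem_left _ _ hs) (I.mul_mem_right _ _ hs)) hc hc0
  change h.coeffHom K 1 ∈ I at hJ
  rwa [map_one] at hJ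

/-- The ordered monomials are linearly independent: apply `one_mem_of_normalForm_mem` to the zero
ideal. -/
theorem normalForm_injective [Nontrivial A] : Function.Injective (h.normalForm K) := by
  rw [injective_iff_map_eq_zero]
  intro p hp
  by_contra hne
  have h1 := h.one_mem_of_normalForm_mem ⊥ hne (by rw [hp]; exact zero_mem _)
  exact one_ne_zero ((TwoSidedIdeal.mem_bot A).1 h1)

theorem isSimpleRing [Nontrivial A] (hsurj : Function.Surjective (h.normalForm K)) :
    IsSimpleRing A := by
  refine IsSimpleRing.of_eq_bot_or_eq_top fun I => or_iff_not_imp_left.2 fun hI => ?_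
  obtain ⟨a, ha, ha0⟩ : ∃ a ∈ I, a ≠ 0 := by
    by_contra! hall
    exact hI (le_bot_iff.1 fun a ha => (TwoSidedIdeal.mem_bot A).2 (hall a ha))
  obtain ⟨p, rfl⟩ := hsurj a
  exact I.one_mem_iff.1 (h.one_mem_of_normalForm_mem I (fun hp => ha0 (by simp [hp])) ha)

end CharZero

/-! ### The filtration by total degree -/

section Filtration

variable (K) in
/-- The span of the products `s * p` of a polynomial `s` in `t, u` and a polynomial `p` in the
`x_i`, of total degree at most `m` altogether. -/
noncomputable def filtration (m : ℕ) : Submodule K A :=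
  Submodule.span K {a | ∃ (s : MvPolynomial (Option ι) K) (p : MvPolynomial ι K),
    s.totalDegree + p.totalDegree ≤ m ∧ h.coeffHom K s * h.symbolHom K p = a}

theorem mul_mem_filtration {m : ℕ} {s : MvPolynomial (Option ι) K} {p : MvPolynomial ι K}
    (hm : s.totalDegree + p.totalDegree ≤ m) :
    h.coeffHom K s * h.symbolHom K p ∈ h.filtration K m :=
  Submodule.subset_span ⟨s, p, hm, rfl⟩

variable (K x t u) in
/-- The span of `1` and of the elements `x_i`, `t_i`, `u`. -/
def generatingSpace : Submodule K A :=
  Submodule.span K (insert 1 (insert u (Set.range x ∪ Set.range t)))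

theorem generatingSpace_mul_filtration_le (m : ℕ) :
    generatingSpace K x t u * h.filtration K m ≤ h.filtration K (m + 1) := by
  rw [generatingSpace, filtration, Submodule.span_mul_span, Submodule.span_le]
  rintro _ ⟨g, hg, _, ⟨s, p, hm, rfl⟩, rfl⟩
  change g * (h.coeffHom K s * h.symbolHom K p) ∈ h.filtration K (m + 1)
  rcases hg with rfl | hg | ⟨i, rfl⟩ | ⟨i, rfl⟩
  · rw [one_mul]
    exact h.mul_mem_filtration (by omega)
  · have hu : u * h.coeffHom K s = h.coeffHom K (X none * s) := by rw [map_mul, coeffHom_X_none]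
    rw [hg, ← mul_assoc, hu]
    refine h.mul_mem_filtration ?_
    have := totalDegree_mul (X none) s
    rw [totalDegree_X] at this
    omega
  · rw [← mul_assoc, x_mul_coeffHom, add_mul, mul_assoc, ← h.symbolHom_X (K := K), ← map_mul]
    refine add_mem (h.mul_mem_filtration ?_) (h.mul_mem_filtration ?_)
    · have := totalDegree_mul (X i) p
      rw [totalDegree_X] at this
      omega
    · have := totalDegree_shamsuddinDerivation_le K o i s
      omega
  · rw [← mul_assoc, ← h.coeffHom_X_some (K := K), ← map_mul]
    refine h.mul_mem_filtration ?_
    have := totalDegree_mul (X (some i)) s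
    rw [totalDegree_X] at this
    omega

theorem generatingSpace_pow_le_filtration (m : ℕ) :
    generatingSpace K x t u ^ m ≤ h.filtration K m := by
  induction m with
  | zero =>
    rw [pow_zero, Submodule.one_le]
    simpa using h.mul_mem_filtration (K := K) (m := 0) (s := 1) (p := 1) (by simp)
  | succ m ih =>
    rw [pow_succ']
    exact (mul_le_mul_right ih _).trans (h.generatingSpace_mul_filtration_le m)

theorem filtration_le_range (m : ℕ) : h.filtration K m ≤ LinearMap.range (h.normalForm K) := by
  rw [filtration, Submodule.span_le]
  rintro _ ⟨s, p, -, rfl⟩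
  exact ⟨_, h.normalForm_algebraTensorAlgEquiv s p⟩

end Filtration

end IsShamsuddinSystem

end System

/-! ### Growth exponents -/

section Growth

variable {K A : Type*} [Field K] [Ring A] [Algebra K A]

theorem Submodule.pow_mono_of_one_mem {V : Submodule K A} (h1 : (1 : A) ∈ V) {m n : ℕ}
    (h : m ≤ n) : V ^ m ≤ V ^ n :=
  pow_le_pow_right₀ (Submodule.one_le.2 h1) h

theorem Submodule.exists_mem_pow_of_adjoin_eq_top {V : Submodule K A} (h1 : (1 : A) ∈ V)
    (hV : Algebra.adjoin K (V : Set A) = ⊤) (a : A) : ∃ r : ℕ, a ∈ V ^ r := by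
  have ha : a ∈ Algebra.adjoin K (V : Set A) := hV ▸ Algebra.mem_top
  induction ha using Algebra.adjoin_induction with
  | mem x hx => exact ⟨1, by rwa [pow_one]⟩
  | algebraMap r => exact ⟨0, by rw [pow_zero]; exact Submodule.algebraMap_mem r⟩
  | add x y _ _ hx hy =>
    obtain ⟨r, hr⟩ := hx
    obtain ⟨s, hs⟩ := hy
    exact ⟨max r s, add_mem (pow_mono_of_one_mem h1 (le_max_left r s) hr)
      (pow_mono_of_one_mem h1 (le_max_right r s) hs)⟩
  | mul x y _ _ hx hy =>
    obtain ⟨r, hr⟩ := hx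
    obtain ⟨s, hs⟩ := hy
    exact ⟨r + s, by rw [pow_add]; exact Submodule.mul_mem_mul hr hs⟩

/-- A finite-dimensional subspace lies in some power of any generating subspace containing `1`. -/
theorem Submodule.exists_le_pow_of_adjoin_eq_top {V : Submodule K A} (h1 : (1 : A) ∈ V)
    (hV : Algebra.adjoin K (V : Set A) = ⊤) (W : Submodule K A) [FiniteDimensional K W] :
    ∃ r : ℕ, 1 ≤ r ∧ W ≤ V ^ r := by
  choose f hf using exists_mem_pow_of_adjoin_eq_top h1 hV
  obtain ⟨S, hS⟩ : W.FG := (Submodule.fg_iff_finiteDimensional W).2 inferInstance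
  refine ⟨S.sup f + 1, by omega, ?_⟩
  rw [← hS, Submodule.span_le]
  exact fun a ha => pow_mono_of_one_mem h1 ((Finset.le_sup ha).trans (Nat.le_succ _)) (hf a)

theorem Submodule.finiteDimensional_pow (V : Submodule K A) [FiniteDimensional K V] (m : ℕ) :
    FiniteDimensional K (V ^ m : Submodule K A) :=
  (Submodule.fg_iff_finiteDimensional _).1
    (((Submodule.fg_iff_finiteDimensional V).2 inferInstance).pow m)

theorem tendsto_const_mul_div_log_add_one (N : ℕ) (c : ℝ) :
    Filter.Tendsto (fun m : ℕ => (((N : ℝ) * (c / Real.log m + 1) : ℝ) : EReal)) Filter.atTop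
      (nhds (N : EReal)) := by
  have h1 : Filter.Tendsto (fun m : ℕ => Real.log (m : ℝ)) Filter.atTop Filter.atTop :=
    Real.tendsto_log_atTop.comp tendsto_natCast_atTop_atTop
  have h2 : Filter.Tendsto (fun m : ℕ => (N : ℝ) * (c / Real.log m + 1)) Filter.atTop
      (nhds (N : ℝ)) := by
    simpa using ((h1.const_div_atTop c).add_const 1).const_mul (N : ℝ)
  rw [← EReal.coe_coe_eq_natCast]
  exact (continuous_coe_real_ereal.tendsto _).comp h2

theorem growthExponent_le_of_finrank_pow_le {V : Submodule K A} (N c : ℕ)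
    (h : ∀ m : ℕ, Module.finrank K (V ^ m : Submodule K A) ≤ (c * m + 1) ^ N) :
    growthExponent K V ≤ N := by
  rw [← (tendsto_const_mul_div_log_add_one N (Real.log (c + 1))).limsup_eq, growthExponent]
  refine Filter.limsup_le_limsup ?_
  filter_upwards [Filter.eventually_ge_atTop 2] with m hm
  rw [EReal.coe_le_coe_iff]
  have hm2 : (2 : ℝ) ≤ m := by exact_mod_cast hm
  have hlog : 0 < Real.log m := Real.log_pos (by linarith)
  have hc : (0 : ℝ) ≤ c := Nat.cast_nonneg c
  have hrhs : (N : ℝ) * (Real.log (c + 1) / Real.log m + 1) =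
      Real.log ((((c : ℝ) + 1) * m) ^ N) / Real.log m := by
    rw [Real.log_pow, Real.log_mul (by positivity) (by positivity)]
    field_simp
  rw [hrhs]
  refine div_le_div_of_nonneg_right ?_ hlog.le
  rcases Nat.eq_zero_or_pos (Module.finrank K (V ^ m : Submodule K A)) with h0 | h0
  · -- A zero dimension contributes the junk value `log 0 = 0`, which is harmless here.
    rw [h0, Nat.cast_zero, Real.log_zero]
    exact Real.log_nonneg (one_le_pow₀ (by nlinarith))
  · refine Real.log_le_log (by exact_mod_cast h0) ?_
    calc (Module.finrank K (V ^ m : Submodule K A) : ℝ) ≤ ((c * m + 1 : ℕ) : ℝ) ^ N := by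
          exact_mod_cast h m
      _ ≤ (((c : ℝ) + 1) * m) ^ N := by
          gcongr
          push_cast
          nlinarith

theorem le_growthExponent_of_le_finrank_pow {V : Submodule K A} (N q : ℕ) (hq : 1 ≤ q)
    (h : ∀ m : ℕ, (m / q + 1) ^ N ≤ Module.finrank K (V ^ m : Submodule K A)) :
    (N : EReal) ≤ growthExponent K V := by
  rw [← (tendsto_const_mul_div_log_add_one N (-Real.log q)).limsup_eq, growthExponent]
  refine Filter.limsup_le_limsup ?_
  filter_upwards [Filter.eventually_ge_atTop 2] with m hm
  rw [EReal.coe_le_coe_iff]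
  have hm2 : (2 : ℝ) ≤ m := by exact_mod_cast hm
  have hlog : 0 < Real.log m := Real.log_pos (by linarith)
  have hq0 : (0 : ℝ) < q := by exact_mod_cast hq
  have hlhs : (N : ℝ) * (-Real.log q / Real.log m + 1) =
      Real.log (((m : ℝ) / q) ^ N) / Real.log m := by
    rw [Real.log_pow, Real.log_div (by positivity) (by positivity)]
    field_simp
    ring
  rw [hlhs]
  refine div_le_div_of_nonneg_right (Real.log_le_log (by positivity) ?_) hlog.le
  calc ((m : ℝ) / q) ^ N ≤ ((m / q + 1 : ℕ) : ℝ) ^ N := by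
        gcongr
        rw [div_le_iff₀ hq0]
        have := (Nat.lt_div_mul_add (a := m) (b := q) hq).le
        have h2 : m ≤ (m / q + 1) * q := by linarith
        exact_mod_cast h2
    _ ≤ (Module.finrank K (V ^ m : Submodule K A) : ℝ) := by exact_mod_cast h m

end Growth

/-! ### Monomials with exponents in a box -/

section Monomials

variable (K : Type*) [Field K] {κ : Type*} [Fintype κ]

/-- The exponent vector with entries `e i`, for an element `e` of the box `{0, …, m} ^ κ`. -/
noncomputable def boxExponent {m : ℕ} (e : κ → Fin (m + 1)) : κ →₀ ℕ :=
  Finsupp.equivFunOnFinite.symm fun i => (e i : ℕ)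

theorem boxExponent_injective (m : ℕ) :
    Function.Injective (boxExponent : (κ → Fin (m + 1)) → κ →₀ ℕ) := by
  intro e e' h
  funext i
  exact Fin.ext (DFunLike.congr_fun h i)

theorem degree_boxExponent_le {m : ℕ} (e : κ → Fin (m + 1)) :
    (boxExponent e).degree ≤ Fintype.card κ * m := by
  rw [Finsupp.degree_eq_sum, ← smul_eq_mul, ← Finset.card_univ, ← Finset.sum_const]
  exact Finset.sum_le_sum fun i _ => Nat.lt_succ_iff.1 (e i).2

theorem MvPolynomial.mem_span_boxExponent {m : ℕ} {p : MvPolynomial κ K}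
    (hp : p.totalDegree ≤ m) :
    p ∈ Submodule.span K (Set.range fun e : κ → Fin (m + 1) =>
      (monomial (boxExponent e) 1 : MvPolynomial κ K)) := by
  rw [p.as_sum]
  refine sum_mem fun α hα => ?_
  have h1 : monomial α (coeff α p) = coeff α p • (monomial α 1 : MvPolynomial κ K) := by
    rw [smul_monomial, smul_eq_mul, mul_one]
  rw [h1]
  refine Submodule.smul_mem _ _ (Submodule.subset_span ?_)
  have h2 : ∀ i, α i < m + 1 := fun i => Nat.lt_succ_iff.2 <|
    (monomial_le_degreeOf i hα).trans ((degreeOf_le_totalDegree p i).trans hp)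
  have h3 : boxExponent (fun i => ⟨α i, h2 i⟩) = α := Finsupp.ext fun _ => rfl
  exact ⟨fun i => ⟨α i, h2 i⟩, congrArg (fun β => monomial β 1) h3⟩

theorem card_boxExponent (κ : Type*) [Fintype κ] [DecidableEq κ] (m : ℕ) :
    Fintype.card ((κ → Fin (m + 1)) × (Option κ → Fin (m + 1))) =
      (m + 1) ^ (2 * Fintype.card κ + 1) := by
  rw [Fintype.card_prod, Fintype.card_fun, Fintype.card_fun, Fintype.card_fin,
    Fintype.card_option, ← pow_add]
  congr 1
  ring

end Monomials

theorem AlgHom.map_monomial_mem_pow {K A κ : Type*} [Field K] [Ring A] [Algebra K A]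
    (φ : MvPolynomial κ K →ₐ[K] A) {W : Submodule K A} (hφ : ∀ i, φ (X i) ∈ W) (α : κ →₀ ℕ) :
    φ (monomial α 1) ∈ W ^ α.degree := by
  induction α using Finsupp.induction_linear with
  | zero =>
    rw [monomial_zero', C_1, map_one, map_zero, pow_zero]
    exact Submodule.one_le.1 le_rfl
  | add α β hα hβ =>
    rw [map_add, pow_add, ← one_mul (1 : K), ← monomial_mul, map_mul]
    exact Submodule.mul_mem_mul hα hβ
  | single i k =>
    rw [Finsupp.degree_single, ← X_pow_eq_monomial, map_pow]
    exact Submodule.pow_mem_pow _ (hφ i) k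

/-! ### Gelfand–Kirillov dimension -/

namespace IsShamsuddinSystem

section GeneratingSpace

variable {K A ι : Type*} [Field K] [Ring A] [Algebra K A] {x t : ι → A} {u : A}

theorem one_mem_generatingSpace : (1 : A) ∈ generatingSpace K x t u :=
  Submodule.subset_span (Or.inl rfl)

theorem x_mem_generatingSpace (i : ι) : x i ∈ generatingSpace K x t u :=
  Submodule.subset_span (Or.inr (Or.inr (Or.inl ⟨i, rfl⟩)))

theorem t_mem_generatingSpace (i : ι) : t i ∈ generatingSpace K x t u :=
  Submodule.subset_span (Or.inr (Or.inr (Or.inr ⟨i, rfl⟩)))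

theorem u_mem_generatingSpace : u ∈ generatingSpace K x t u :=
  Submodule.subset_span (Or.inr (Or.inl rfl))

instance [Finite ι] : FiniteDimensional K (generatingSpace K x t u) :=
  FiniteDimensional.span_of_finite K
    (((Set.finite_range x).union (Set.finite_range t)).insert u |>.insert 1)

end GeneratingSpace

variable {K A ι : Type*} [Field K] [Ring A] [Algebra K A] [DecidableEq ι]
  {o : ι} {x t : ι → A} {u : A} (h : IsShamsuddinSystem o x t u)

theorem normalForm_surjective
    (hgen : Algebra.adjoin K (generatingSpace K x t u : Set A) = ⊤) :
    Function.Surjective (h.normalForm K) := by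
  intro a
  obtain ⟨r, hr⟩ := Submodule.exists_mem_pow_of_adjoin_eq_top one_mem_generatingSpace hgen a
  exact h.filtration_le_range r (h.generatingSpace_pow_le_filtration r hr)

variable (K) in
/-- The ordered monomials: powers of the `t_i` and `u`, with exponents in the second component,
followed by powers of the `x_i`, with exponents in the first component. -/
noncomputable def orderedMonomial (e : (ι →₀ ℕ) × (Option ι →₀ ℕ)) : A :=
  h.coeffHom K (monomial e.2 1) * h.symbolHom K (monomial e.1 1)

theorem linearIndependent_orderedMonomial [CharZero K] [Nontrivial A] :
    LinearIndependent K (h.orderedMonomial K) := by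
  have h1 := ((basisMonomials (Option ι) K).smulTower
    (basisMonomials ι (MvPolynomial (Option ι) K))).linearIndependent.map'
      (h.normalForm K) (LinearMap.ker_eq_bot.2 h.normalForm_injective)
  have h2 := h1.comp Prod.swap Prod.swap_injective
  convert! h2 using 1
  funext e
  simp [orderedMonomial, Module.Basis.smulTower_apply, smul_monomial, normalForm_monomial]

theorem orderedMonomial_mem_pow (e : (ι →₀ ℕ) × (Option ι →₀ ℕ)) :
    h.orderedMonomial K e ∈ generatingSpace K x t u ^ (e.2.degree + e.1.degree) := by
  rw [pow_add]
  refine Submodule.mul_mem_mul (AlgHom.map_monomial_mem_pow _ ?_ _)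
    (AlgHom.map_monomial_mem_pow _ ?_ _)
  · rintro (_ | i)
    · rw [coeffHom_X_none]
      exact u_mem_generatingSpace
    · rw [coeffHom_X_some]
      exact t_mem_generatingSpace i
  · intro i
    rw [symbolHom_X]
    exact x_mem_generatingSpace i

variable [Fintype ι]

theorem filtration_le_span (m : ℕ) :
    h.filtration K m ≤ Submodule.span K (Set.range
      fun e : (ι → Fin (m + 1)) × (Option ι → Fin (m + 1)) =>
        h.orderedMonomial K (boxExponent e.1, boxExponent e.2)) := by
  rw [filtration, Submodule.span_le]
  rintro _ ⟨s, p, hm, rfl⟩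
  have hs := Submodule.mem_map_of_mem (f := (h.coeffHom K).toLinearMap)
    (mem_span_boxExponent K (p := s) (m := m) (by omega))
  have hp := Submodule.mem_map_of_mem (f := (h.symbolHom K).toLinearMap)
    (mem_span_boxExponent K (p := p) (m := m) (by omega))
  have hsp := Submodule.mul_mem_mul hs hp
  rw [Submodule.map_span, Submodule.map_span, Submodule.span_mul_span] at hsp
  refine Submodule.span_mono ?_ hsp
  rintro _ ⟨_, ⟨_, ⟨e, rfl⟩, rfl⟩, _, ⟨_, ⟨e', rfl⟩, rfl⟩, rfl⟩
  exact ⟨(e', e), rfl⟩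

theorem finiteDimensional_filtration (m : ℕ) : FiniteDimensional K (h.filtration K m) :=
  have := FiniteDimensional.span_of_finite K (Set.finite_range
      fun e : (ι → Fin (m + 1)) × (Option ι → Fin (m + 1)) =>
        h.orderedMonomial K (boxExponent e.1, boxExponent e.2))
  Submodule.finiteDimensional_of_le (h.filtration_le_span m)

theorem finrank_filtration_le (m : ℕ) :
    Module.finrank K (h.filtration K m) ≤ (m + 1) ^ (2 * Fintype.card ι + 1) := by
  have := FiniteDimensional.span_of_finite K (Set.finite_range
      fun e : (ι → Fin (m + 1)) × (Option ι → Fin (m + 1)) =>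
        h.orderedMonomial K (boxExponent e.1, boxExponent e.2))
  rw [← card_boxExponent]
  exact (Submodule.finrank_mono (h.filtration_le_span m)).trans (finrank_range_le_card _)

/-- The ordered monomials with all exponents at most `m / N`, where `N` is the number of variables,
have total degree at most `m`. -/
theorem le_finrank_generatingSpace_pow [CharZero K] [Nontrivial A]
    (h : IsShamsuddinSystem o x t u) (m : ℕ) :
    (m / (2 * Fintype.card ι + 1) + 1) ^ (2 * Fintype.card ι + 1) ≤
      Module.finrank K (generatingSpace K x t u ^ m : Submodule K A) := by
  set N := 2 * Fintype.card ι + 1 with hN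
  have := Submodule.finiteDimensional_pow (generatingSpace K x t u) m
  have hli := h.linearIndependent_orderedMonomial (K := K).comp
    (fun e : (ι → Fin (m / N + 1)) × (Option ι → Fin (m / N + 1)) =>
      (boxExponent e.1, boxExponent e.2))
    (Function.Injective.prodMap (boxExponent_injective _) (boxExponent_injective _))
  rw [hN, ← card_boxExponent, ← finrank_span_eq_card hli]
  refine Submodule.finrank_mono (Submodule.span_le.2 ?_)
  rintro _ ⟨e, rfl⟩
  refine Submodule.pow_mono_of_one_mem one_mem_generatingSpace ?_
    (h.orderedMonomial_mem_pow _)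
  have h1 := degree_boxExponent_le e.1
  have h2 := degree_boxExponent_le e.2
  rw [Fintype.card_option] at h2
  have h3 := Nat.div_mul_le_self m N
  simp only
  nlinarith

/-- Any finite-dimensional `V` lies in the `r`-th power of the generating space, so `V ^ m` lies in
the `r * m`-th step of the filtration. -/
theorem growthExponent_le
    (h : IsShamsuddinSystem o x t u)
    (hgen : Algebra.adjoin K (generatingSpace K x t u : Set A) = ⊤) (V : Submodule K A)
    [FiniteDimensional K V] :
    growthExponent K V ≤ ((2 * Fintype.card ι + 1 : ℕ) : EReal) := by
  obtain ⟨r, -, hr⟩ :=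
    Submodule.exists_le_pow_of_adjoin_eq_top one_mem_generatingSpace hgen V
  refine growthExponent_le_of_finrank_pow_le _ r fun m => ?_
  refine le_trans ?_ (h.finrank_filtration_le (K := K) (r * m))
  have := h.finiteDimensional_filtration (K := K) (r * m)
  refine Submodule.finrank_mono ?_
  calc V ^ m ≤ (generatingSpace K x t u ^ r) ^ m := pow_le_pow_left' hr m
    _ = generatingSpace K x t u ^ (r * m) := (pow_mul _ _ _).symm
    _ ≤ _ := h.generatingSpace_pow_le_filtration _

/-- The generating space lies in `V ^ r` for some `r`, so its power with exponent `m / r` lies in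
`V ^ m`. -/
theorem le_growthExponent [CharZero K] [Nontrivial A]
    (h : IsShamsuddinSystem o x t u) {V : Submodule K A}
    [FiniteDimensional K V] (h1 : (1 : A) ∈ V) (hV : Algebra.adjoin K (V : Set A) = ⊤) :
    ((2 * Fintype.card ι + 1 : ℕ) : EReal) ≤ growthExponent K V := by
  obtain ⟨r, hr1, hr⟩ :=
    Submodule.exists_le_pow_of_adjoin_eq_top h1 hV (generatingSpace K x t u)
  refine le_growthExponent_of_le_finrank_pow _ (r * (2 * Fintype.card ι + 1))
    (Nat.mul_pos hr1 (Nat.succ_pos _)) fun m => ?_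
  rw [← Nat.div_div_eq_div_mul]
  refine (h.le_finrank_generatingSpace_pow (K := K) (m / r)).trans ?_
  have := Submodule.finiteDimensional_pow V m
  refine Submodule.finrank_mono ?_
  calc generatingSpace K x t u ^ (m / r) ≤ (V ^ r) ^ (m / r) := pow_le_pow_left' hr _
    _ = V ^ (r * (m / r)) := (pow_mul _ _ _).symm
    _ ≤ V ^ m := Submodule.pow_mono_of_one_mem h1 (Nat.mul_div_le m r)

theorem growthExponent_eq [CharZero K] [Nontrivial A]
    (h : IsShamsuddinSystem o x t u)
    (hgen : Algebra.adjoin K (generatingSpace K x t u : Set A) = ⊤) {V : Submodule K A}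
    [FiniteDimensional K V] (h1 : (1 : A) ∈ V) (hV : Algebra.adjoin K (V : Set A) = ⊤) :
    growthExponent K V = ((2 * Fintype.card ι + 1 : ℕ) : EReal) :=
  (h.growthExponent_le hgen V).antisymm (h.le_growthExponent h1 hV)

theorem gkDim_eq [CharZero K] [Nontrivial A]
    (h : IsShamsuddinSystem o x t u)
    (hgen : Algebra.adjoin K (generatingSpace K x t u : Set A) = ⊤) :
    gkDim K A = ((2 * Fintype.card ι + 1 : ℕ) : EReal) := by
  refine le_antisymm (iSup_le fun V => iSup_le fun _ => iSup_le fun _ =>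
    h.growthExponent_le hgen V) ?_
  rw [← h.growthExponent_eq hgen one_mem_generatingSpace hgen, gkDim]
  exact le_iSup_of_le (generatingSpace K x t u)
    (le_iSup_of_le inferInstance (le_iSup_of_le one_mem_generatingSpace le_rfl))

end IsShamsuddinSystem

/-! ### The algebras `A_n` -/

/-- The operators `D_i`, together with the multiplications by the variables, on `K[t, u]`. -/
theorem isShamsuddinSystem_end (K : Type*) [Field K] {ι : Type*} [DecidableEq ι] (o : ι) :
    IsShamsuddinSystem (A := Module.End K (MvPolynomial (Option ι) K)) o
      (fun i => (shamsuddinDerivation K o i : Module.End K (MvPolynomial (Option ι) K)))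
      (fun i => LinearMap.mulLeft K (X (some i))) (LinearMap.mulLeft K (X none)) where
  x_mul_x i j := LinearMap.ext fun f => shamsuddinDerivation_comm K o i j f
  t_mul_t i j := LinearMap.ext fun f => mul_left_comm _ _ f
  t_mul_u i := LinearMap.ext fun f => mul_left_comm _ _ f
  x_mul_t i j := by
    refine LinearMap.ext fun f => ?_
    simp only [Module.End.mul_apply, LinearMap.add_apply, LinearMap.mulLeft_apply,
      Derivation.coeFn_coe, Derivation.leibniz, shamsuddinDerivation_X_some, smul_eq_mul]
    split_ifs <;> simp
  x_mul_u i := by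
    refine LinearMap.ext fun f => ?_
    simp only [Module.End.mul_apply, LinearMap.add_apply, LinearMap.mulLeft_apply,
      Derivation.coeFn_coe, Derivation.leibniz, shamsuddinDerivation_X_none, smul_eq_mul]
    split_ifs
    · simp only [LinearMap.neg_apply, LinearMap.add_apply, Module.End.one_apply,
        Module.End.mul_apply, LinearMap.mulLeft_apply]
      ring
    · simp

namespace OddAlgebra

section Presentation

variable {K : Type u} [Field K] {n : ℕ}

variable (K) in
/-- The image of a letter in the algebra `A_n`. -/
noncomputable def gen (g : OddGen n) : OddAlgebra K n :=
  RingQuot.mkAlgHom K (OddRel K n) (FreeAlgebra.ι K g)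

theorem adjoin_range_gen : Algebra.adjoin K (Set.range (gen K : OddGen n → _)) = ⊤ := by
  have h1 : Set.range (gen K : OddGen n → _) =
      RingQuot.mkAlgHom K (OddRel K n) '' Set.range (FreeAlgebra.ι K) := by
    rw [← Set.range_comp]
    rfl
  rw [h1, ← AlgHom.map_adjoin, FreeAlgebra.adjoin_range_ι, Algebra.map_top, AlgHom.range_eq_top]
  exact RingQuot.mkAlgHom_surjective K _

open OddGen (x y z) in
/-- In `A_n` put `t_1 = y`, `t_i = z_i` for `i ≠ 1` and `u = x_1 + z_1`. The relation between `x_1`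
and `z_1` becomes `[x_1, u] = -(1 + y u)`, and `u` commutes with every `t_i`. -/
theorem isShamsuddinSystem (o : Fin n) (ho : (o : ℕ) = 0) :
    IsShamsuddinSystem o (fun i => gen K (x i)) (fun i => gen K (if i = o then y else z i))
      (gen K (x o) + gen K (z o)) := by
  have hne : ∀ {i : Fin n}, i ≠ o → (i : ℕ) ≠ 0 := fun hi h => hi (Fin.ext (h.trans ho.symm))
  have hrel : ∀ {a b c : FreeAlgebra K (OddGen n)}, OddRel K n ⁅a, b⁆ c →
      RingQuot.mkAlgHom K (OddRel K n) a * RingQuot.mkAlgHom K (OddRel K n) b =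
        RingQuot.mkAlgHom K (OddRel K n) b * RingQuot.mkAlgHom K (OddRel K n) a +
          RingQuot.mkAlgHom K (OddRel K n) c := by
    intro a b c h
    rw [← sub_eq_iff_eq_add', ← RingQuot.mkAlgHom_rel K h, Ring.lie_def, map_sub, map_mul, map_mul]
  have hxoy : gen K (x o) * gen K y = gen K y * gen K (x o) + 1 := by
    simpa [gen, OddGen.X, OddGen.Y, OddGen.Z] using hrel (OddRel.x_one_y o ho)
  have hyzo : gen K y * gen K (z o) = gen K (z o) * gen K y + 1 := by
    simpa [gen, OddGen.X, OddGen.Y, OddGen.Z] using hrel (OddRel.y_z_one o ho)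
  have hxzo : gen K (x o) * gen K (z o) = gen K (z o) * gen K (x o) +
      (-(gen K (x o) * gen K y) - gen K y * gen K (z o)) := by
    simpa [gen, OddGen.X, OddGen.Y, OddGen.Z] using hrel (OddRel.x_one_z_one o ho)
  have hxz_same : ∀ i, i ≠ o → gen K (x i) * gen K (z i) = gen K (z i) * gen K (x i) + 1 := by
    intro i hi
    simpa [gen, OddGen.X, OddGen.Y, OddGen.Z] using hrel (OddRel.x_z_same i (hne hi))
  have hxx : ∀ i j : Fin n, gen K (x i) * gen K (x j) = gen K (x j) * gen K (x i) := by
    intro i j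
    by_cases hij : i = j
    · rw [hij]
    · simpa [gen, OddGen.X, OddGen.Y, OddGen.Z] using hrel (OddRel.x_x i j hij)
  have hzz : ∀ i j : Fin n, gen K (z i) * gen K (z j) = gen K (z j) * gen K (z i) := by
    intro i j
    by_cases hij : i = j
    · rw [hij]
    · simpa [gen, OddGen.X, OddGen.Y, OddGen.Z] using hrel (OddRel.z_z i j hij)
  have hxz : ∀ i j : Fin n, i ≠ j → gen K (x i) * gen K (z j) = gen K (z j) * gen K (x i) := by
    intro i j hij
    simpa [gen, OddGen.X, OddGen.Y, OddGen.Z] using hrel (OddRel.x_z i j hij)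
  have hxy : ∀ i, i ≠ o → gen K (x i) * gen K y = gen K y * gen K (x i) := by
    intro i hi
    simpa [gen, OddGen.X, OddGen.Y, OddGen.Z] using hrel (OddRel.x_y i (hne hi))
  have hyz : ∀ i, i ≠ o → gen K y * gen K (z i) = gen K (z i) * gen K y := by
    intro i hi
    simpa [gen, OddGen.X, OddGen.Y, OddGen.Z] using hrel (OddRel.y_z i (hne hi))
  refine ⟨hxx, fun i j => ?_, fun i => ?_, fun i j => ?_, fun i => ?_⟩
  · split_ifs with hi hj hj
    · rfl
    · exact hyz j hj
    · exact (hyz i hi).symm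
    · exact hzz i j
  · split_ifs with hi
    · rw [mul_add, add_mul, hxoy, hyzo]
      abel
    · rw [mul_add, add_mul, hzz, hxz o i (Ne.symm hi)]
  · by_cases hj : j = o
    · subst hj
      by_cases hi : i = j
      · subst hi
        simpa using hxoy
      · simpa [hi] using hxy i hi
    · by_cases hi : i = j
      · subst hi
        simpa [hj] using hxz_same i hj
      · simpa [hi, hj] using hxz i j hi
  · by_cases hi : i = o
    · subst hi
      simp only [if_true]
      rw [mul_add, add_mul, hxzo, mul_add, hxoy]
      abel
    · rw [if_neg hi, add_zero, mul_add, add_mul, hxx, hxz i o hi]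

open OddGen (x y z) in
/-- `A_n` is universal among the algebras with a system indexed by `Fin n`, so it maps to the
operators on `K[t, u]` and is not the zero ring. -/
theorem nontrivial (o : Fin n) (ho : (o : ℕ) = 0) : Nontrivial (OddAlgebra K n) := by
  have h := isShamsuddinSystem_end K o
  set D : Fin n → Module.End K (MvPolynomial (Option (Fin n)) K) :=
    fun i => (shamsuddinDerivation K o i : Module.End K (MvPolynomial (Option (Fin n)) K))
  set T : Fin n → Module.End K (MvPolynomial (Option (Fin n)) K) :=
    fun i => LinearMap.mulLeft K (MvPolynomial.X (some i))
  set U : Module.End K (MvPolynomial (Option (Fin n)) K) :=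
    LinearMap.mulLeft K (MvPolynomial.X none)
  let f : OddGen n → Module.End K (MvPolynomial (Option (Fin n)) K)
    | x i => D i
    | y => T o
    | z i => if i = o then U - D o else T i
  have hio : ∀ {i : Fin n}, (i : ℕ) = 0 → i = o := fun hi => Fin.ext (hi.trans ho.symm)
  have hne : ∀ {i : Fin n}, (i : ℕ) ≠ 0 → i ≠ o := fun hi h => hi (h ▸ ho)
  have hDU := h.x_mul_u o
  have hDT := h.x_mul_t o o
  rw [if_pos rfl] at hDU hDT
  have hrel : ∀ ⦃a b : FreeAlgebra K (OddGen n)⦄, OddRel K n a b →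
      FreeAlgebra.lift K f a = FreeAlgebra.lift K f b := by
    intro a b hab
    cases hab with
    | x_one_y i hi =>
      obtain rfl := hio hi
      simp [OddGen.X, OddGen.Y, Ring.lie_def, f, hDT]
    | y_z_one i hi =>
      obtain rfl := hio hi
      simp only [OddGen.Y, OddGen.Z, Ring.lie_def, f, map_sub, map_mul, map_one, FreeAlgebra.lift_ι_apply,
        if_true, mul_sub, sub_mul, hDT, h.t_mul_u]
      abel
    | x_z_same i hi => simp [OddGen.X, OddGen.Z, Ring.lie_def, f, hne hi, h.x_mul_t]
    | x_one_z_one i hi =>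
      obtain rfl := hio hi
      simp only [OddGen.X, OddGen.Y, OddGen.Z, Ring.lie_def, f, map_sub, map_neg, map_mul, FreeAlgebra.lift_ι_apply,
        if_true, mul_sub, sub_mul, hDT, hDU]
      abel
    | x_x i j hij => simp [OddGen.X, Ring.lie_def, f, h.x_mul_x i j]
    | x_z i j hij =>
      by_cases hj : j = o
      · subst hj
        simp [OddGen.X, OddGen.Z, Ring.lie_def, f, mul_sub, sub_mul, h.x_mul_u, hij, h.x_mul_x i j]
      · simp [OddGen.X, OddGen.Z, Ring.lie_def, f, hj, h.x_mul_t, hij]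
    | z_z i j hij =>
      by_cases hi : i = o
      · subst hi
        simp [OddGen.Z, Ring.lie_def, f, hij.symm, mul_sub, sub_mul, h.t_mul_u, h.x_mul_t, hij]
      · by_cases hj : j = o
        · subst hj
          simp [OddGen.Z, Ring.lie_def, f, hij, mul_sub, sub_mul, h.t_mul_u, h.x_mul_t, hij.symm]
        · simp [OddGen.Z, Ring.lie_def, f, hi, hj, h.t_mul_t i j]
    | x_y i hi => simp [OddGen.X, OddGen.Y, Ring.lie_def, f, hne hi, h.x_mul_t]
    | y_z i hi => simp [OddGen.Y, OddGen.Z, Ring.lie_def, f, hne hi, h.t_mul_t o i]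
  exact (RingQuot.liftAlgHom K ⟨FreeAlgebra.lift K f, hrel⟩).toRingHom.domain_nontrivial

open OddGen (x y z) in
theorem adjoin_generatingSpace (o : Fin n) :
    Algebra.adjoin K (IsShamsuddinSystem.generatingSpace K (fun i => gen K (x i))
      (fun i => gen K (if i = o then y else z i)) (gen K (x o) + gen K (z o)) :
        Set (OddAlgebra K n)) = ⊤ := by
  rw [eq_top_iff, ← adjoin_range_gen, Algebra.adjoin_le_iff]
  set W := IsShamsuddinSystem.generatingSpace K (fun i => gen K (x i))
      (fun i => gen K (if i = o then y else z i)) (gen K (x o) + gen K (z o)) with hW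
  have hx : ∀ i, gen K (x i) ∈ W := fun i => IsShamsuddinSystem.x_mem_generatingSpace i
  have ht : ∀ i, gen K (if i = o then y else z i) ∈ W :=
    fun i => IsShamsuddinSystem.t_mem_generatingSpace
      (t := fun i => gen K (if i = o then y else z i)) i
  rintro _ ⟨i | _ | i, rfl⟩
  · exact Algebra.subset_adjoin (hx i)
  · exact Algebra.subset_adjoin (by simpa using ht o)
  · by_cases hi : i = o
    · have h1 : gen K (z i) = (gen K (x o) + gen K (z o)) - gen K (x o) := by
        rw [hi, add_sub_cancel_left]
      rw [h1]
      exact Algebra.subset_adjoin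
        (W.sub_mem IsShamsuddinSystem.u_mem_generatingSpace (hx o))
    · exact Algebra.subset_adjoin (by simpa [hi] using ht i)

instance finite_oddGen : Finite (OddGen n) :=
  Finite.of_surjective
    (fun s : Fin n ⊕ Unit ⊕ Fin n =>
      s.elim OddGen.x (Sum.elim (fun _ => OddGen.y) OddGen.z)) <| by
    rintro (i | _ | i)
    exacts [⟨Sum.inl i, rfl⟩, ⟨Sum.inr (Sum.inl ()), rfl⟩, ⟨Sum.inr (Sum.inr i), rfl⟩]

theorem finiteType : Algebra.FiniteType K (OddAlgebra K n) :=
  Algebra.FiniteType.of_surjective (RingQuot.mkAlgHom K (OddRel K n))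
    (RingQuot.mkAlgHom_surjective K _)

end Presentation

end OddAlgebra

theorem mainTheorem3 (K : Type u) [Field K] [CharZero K] :
    (∀ n : ℕ, 1 ≤ n →
      Algebra.FiniteType K (OddAlgebra K n) ∧
      IsSimpleRing (OddAlgebra K n) ∧
      gkDim K (OddAlgebra K n) = ((2 * n + 1 : ℕ) : EReal) ∧
      ∀ V : Submodule K (OddAlgebra K n), FiniteDimensional K V → (1 : OddAlgebra K n) ∈ V →
        Algebra.adjoin K (V : Set (OddAlgebra K n)) = ⊤ →
        growthExponent K V = ((2 * n + 1 : ℕ) : EReal)) ∧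
    (∀ d : ℕ, Odd d → 3 ≤ d →
      ∃ (B : Type u) (_ : Ring B) (_ : Algebra K B),
        Algebra.FiniteType K B ∧ IsSimpleRing B ∧ gkDim K B = (d : EReal)) := by
  have main : ∀ n : ℕ, 1 ≤ n →
      Algebra.FiniteType K (OddAlgebra K n) ∧
      IsSimpleRing (OddAlgebra K n) ∧
      gkDim K (OddAlgebra K n) = ((2 * n + 1 : ℕ) : EReal) ∧
      ∀ V : Submodule K (OddAlgebra K n), FiniteDimensional K V → (1 : OddAlgebra K n) ∈ V →
        Algebra.adjoin K (V : Set (OddAlgebra K n)) = ⊤ →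
        growthExponent K V = ((2 * n + 1 : ℕ) : EReal) := by
    intro n hn
    have hsys := OddAlgebra.isShamsuddinSystem (K := K) (⟨0, hn⟩ : Fin n) rfl
    have hgen := OddAlgebra.adjoin_generatingSpace (K := K) (⟨0, hn⟩ : Fin n)
    have := OddAlgebra.nontrivial (K := K) (⟨0, hn⟩ : Fin n) rfl
    refine ⟨OddAlgebra.finiteType, hsys.isSimpleRing (hsys.normalForm_surjective hgen), ?_, ?_⟩
    · simpa only [Fintype.card_fin] using hsys.gkDim_eq hgen
    · intro V _ h1 hV
      simpa only [Fintype.card_fin] using hsys.growthExponent_eq hgen h1 hV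
  refine ⟨main, ?_⟩
  rintro d ⟨n, rfl⟩ hd
  obtain ⟨hft, hsimple, hgk, -⟩ := main n (by omega)
  exact ⟨OddAlgebra K n, inferInstance, inferInstance, hft, hsimple, hgk⟩
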